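/- A *picture element* (voxel or sub-voxel) is a triple $p=(x,y,t)\in\mathbb{Q}\times\mathbb{Q}\times\mathbb{R}$; its location is $(x,y)\in\mathbb{R}^2$ and its cell is the closed unit square $[x-\tfrac12,x+\tfrac12]\times[y-\tfrac12,y+\tfrac12]$. Let $X\subseteq\mathbb{Q}\times\mathbb{Q}\times\mathbb{R}$. A *video frame* $fr$ in $X$ is a nonempty set of picture elements of $X$ with a common time $t\ge 0$, together with a value mapping $X\to\mathbb{R}$; its *region* $R\subseteq\mathbb{R}^2$ is the union of the cells of its picture elements. A *subimage* $A$ of $fr$ is the restriction of $fr$ to a nonempty subset of its picture elements. A *1-cycle* $E$ in $fr$ is a cyclic sequence of $n\ge 3$ line segments (edges) in the plane, joining the locations of consecutive picture elements $v_0,v_1,\dots,v_{n-1},v_0$ of $fr$, which form a simple closed curve $|E|\subset\mathbb{R}^2$. **Theorem.** Let $A$ be a subimage of a video frame $fr$ and let $E$ be a 1-cycle in $fr$ whose vertices are picture elements of $A$ (in particular, any 1-cycle with its vertices on the boundary of $A$). Let $\operatorname{Int}E$ and $\operatorname{Ext}E$ be the unions of the bounded and of the unbounded connected components of $\mathbb{R}^2\setminus|E|$,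 respectively. Then: 1. $\operatorname{Int}E$ and $\operatorname{Ext}E$ are disjoint, nonempty, open and connected, with union $\mathbb{R}^2\setminus|E|$; $\operatorname{Int}E$ is bounded, $\operatorname{Ext}E$ is unbounded, and each of them has topological boundary $|E|$. 2. $E$ splits the frame into an interior and an exterior subregion: $R\setminus|E|$ is the union of the disjoint nonempty sets $R\cap\operatorname{Int}E$ and $R\cap\operatorname{Ext}E$. 3. The set of picture elements of $fr$ is the union of three pairwise disjoint sets: those located in $\operatorname{Int}E$, those located on $|E|$, and those located in $\operatorname{Ext}E$. 4. If $A$ is bounded by $E$, that is, if the locations of its picture elements lie in a bounded set $K\subset\mathbb{R}^2$ with topological boundary $\partial K=|E|$, then every picture element of $A$ is located in $\operatorname{Int}E$ or on $|E|$, and none in $\operatorname{Ext}E$. -/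

import Mathlib

open Set

/-- A picture element `(x, y, t)`: a rational location `(x, y)` together with an elapsed time `t`. -/
abbrev PictureElement : Type := ℚ × ℚ × ℝ

namespace PictureElement

/-- The location `(x, y)` of a picture element, as a point of the Euclidean plane. -/
def loc (p : PictureElement) : ℝ × ℝ := ((p.1 : ℝ), (p.2.1 : ℝ))

/-- The closed unit cell occupied by a picture element, centred at its location. -/
def cell (p : PictureElement) : Set (ℝ × ℝ) :=
  {z | |z.1 - p.loc.1| ≤ 1 / 2 ∧ |z.2 - p.loc.2| ≤ 1 / 2}

end PictureElement

/-- A planar video frame in a temporal digital topological space `X ⊆ ℚ × ℚ × ℝ`: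
a nonempty set of picture elements of `X` (its voxels and sub-voxels), all with the same elapsed
time, together with the value mapping `X → ℝ`. -/
structure VideoFrame (X : Set PictureElement) where
  time : ℝ
  time_nonneg : 0 ≤ time
  carrier : Set PictureElement
  subset : carrier ⊆ X
  nonempty : carrier.Nonempty
  time_eq : ∀ p ∈ carrier, p.2.2 = time
  value : X → ℝ

/-- The interior side of a plane curve `C`: the union of the bounded components of its
complement. -/
def insideOf (C : Set (ℝ × ℝ)) : Set (ℝ × ℝ) :=
  {z | z ∈ Cᶜ ∧ Bornology.IsBounded (connectedComponentIn Cᶜ z)}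

/-- The exterior side of a plane curve `C`: the union of the unbounded components of its
complement. -/
def outsideOf (C : Set (ℝ × ℝ)) : Set (ℝ × ℝ) :=
  {z | z ∈ Cᶜ ∧ ¬ Bornology.IsBounded (connectedComponentIn Cᶜ z)}

/-- The curve `C` separates the plane as in the Jordan Curve Theorem: its complement is the disjoint
union of two nonempty connected open sets, a bounded interior and an unbounded exterior, each of
which has `C` as its topological boundary. -/
structure SatisfiesJordanCurveTheorem (C : Set (ℝ × ℝ)) : Prop where
  disjoint : Disjoint (insideOf C) (outsideOf C)
  union_eq : insideOf C ∪ outsideOf C = Cᶜ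
  isOpen_inside : IsOpen (insideOf C)
  isOpen_outside : IsOpen (outsideOf C)
  isConnected_inside : IsConnected (insideOf C)
  isConnected_outside : IsConnected (outsideOf C)
  isBounded_inside : Bornology.IsBounded (insideOf C)
  not_isBounded_outside : ¬ Bornology.IsBounded (outsideOf C)
  frontier_inside : frontier (insideOf C) = C
  frontier_outside : frontier (outsideOf C) = C

namespace VideoFrame

variable {X : Set PictureElement}

/-- The planar region covered by a frame: the union of the cells of its picture elements. -/
def region (fr : VideoFrame X) : Set (ℝ × ℝ) := ⋃ p ∈ fr.carrier, p.cell

/-- The picture elements of the frame whose locations lie in a set `S` of the plane. -/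
def elementsIn (fr : VideoFrame X) (S : Set (ℝ × ℝ)) : Set PictureElement :=
  {p | p ∈ fr.carrier ∧ p.loc ∈ S}

/-- A subimage of a frame: a nonempty set of picture elements of the frame, on which the frame is
restricted. -/
structure Subimage (fr : VideoFrame X) where
  carrier : Set PictureElement
  subset : carrier ⊆ fr.carrier
  nonempty : carrier.Nonempty

/-- The restriction of the frame to the subimage. -/
def Subimage.value {fr : VideoFrame X} (A : fr.Subimage) : A.carrier → ℝ :=
  fun p => fr.value ⟨p.1, fr.subset (A.subset p.2)⟩

/-- A 1-cycle in a frame: a cyclic sequence of edges (line segments) attached to picture elements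
`vertex i` of the frame, the `i`-th edge leading from `vertex i` to `vertex (i + 1)`, such that the
closed polygonal path which they form is simple: different parameters `(i, s)`, with `s ∈ [0, 1)`,
give different points. -/
structure OneCycle (fr : VideoFrame X) where
  n : ℕ
  three_le : 3 ≤ n
  vertex : ZMod n → PictureElement
  vertex_mem : ∀ i, vertex i ∈ fr.carrier
  simple : InjOn
    (fun q : ZMod n × ℝ => AffineMap.lineMap (vertex q.1).loc (vertex (q.1 + 1)).loc q.2)
    (univ ×ˢ Ico (0 : ℝ) 1)

namespace OneCycle

variable {fr : VideoFrame X}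

/-- The `i`-th edge. -/
def edge (c : fr.OneCycle) (i : ZMod c.n) : Set (ℝ × ℝ) :=
  segment ℝ (c.vertex i).loc (c.vertex (i + 1)).loc

/-- The simple closed polygonal curve formed by the edges. -/
def curve (c : fr.OneCycle) : Set (ℝ × ℝ) := ⋃ i, c.edge i

/-- The interior of the 1-cycle in the plane. -/
def inside (c : fr.OneCycle) : Set (ℝ × ℝ) := insideOf c.curve

/-- The exterior of the 1-cycle in the plane. -/
def outside (c : fr.OneCycle) : Set (ℝ × ℝ) := outsideOf c.curve

/-- The edges of the 1-cycle are attached to picture elements of the subimage `A`. -/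
def IsAttachedTo (c : fr.OneCycle) (A : fr.Subimage) : Prop :=
  ∀ i, c.vertex i ∈ A.carrier

/-- The subimage `A` is bounded by the 1-cycle: it lies in a bounded region of the plane whose
topological boundary is the curve. -/
def Bounds (c : fr.OneCycle) (A : fr.Subimage) : Prop :=
  ∃ K : Set (ℝ × ℝ), Bornology.IsBounded K ∧ frontier K = c.curve ∧ ∀ p ∈ A.carrier, p.loc ∈ K

end OneCycle

end VideoFrame

/-!
The heart of the matter is the Jordan curve theorem for simple closed polygons `C`; the statements
about frames follow from it because cells are neighbourhoods of the locations of their elements.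

*At most two components.* Let `U` be a component of the complement of `C`. Its frontier is a closed
subset of `C`. It contains an edge as soon as it contains an inner point of it
(`IsSimplePolygon.segment_subset_frontier`), since near an inner point the complement of `C`
consists of two half balls, and `U` contains one of these or misses both. It cannot stop at a
vertex either (`IsSimplePolygon.exists_mem_openSegment_frontier`), since a ball slit along a radius
is connected. Going round the polygon, the frontier of `U` is all of `C`
(`IsSimplePolygon.frontier_component`). In particular, `U` contains one of the two half balls at
the midpoint of a fixed edge, so that there are at most two choices for `U`.

*At least two components.* For `z` off the curve, add up the angles under which the edges are seen
from `z`, as arguments of `(v (i + 1) - z) / (v i - z)`. Each argument is continuous at `z`, because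
the quotient is a nonpositive real only for `z` on the edge; the sum is a multiple of `2π`, because
the product of the quotients is `1`. So the sum is constant on connected sets off the curve
(`IsPreconnected.windingAngle_eq`). It vanishes far away
(`eventually_windingAngle_eq_zero`), and takes different values on the two sides of an edge
(`IsSimplePolygon.eventually_windingAngle_ne`). Hence there are two components, and not both
are unbounded.
-/

open Filter Topology

/-! ### Connected components of the complement of a closed set -/

section Components

variable {E : Type*} [TopologicalSpace E]

theorem IsPreconnected.subset_of_disjoint_frontier {S U : Set E} (hS : IsPreconnected S)
    (hU : IsOpen U) (hne : (S ∩ U).Nonempty) (hd : Disjoint S (frontier U)) : S ⊆ U := by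
  refine hS.subset_of_closure_inter_subset hU hne ?_
  rintro x ⟨hx, hxS⟩
  by_contra hxU
  refine disjoint_left.1 hd hxS ?_
  rw [hU.frontier_eq]
  exact ⟨hx, hxU⟩

theorem frontier_connectedComponentIn_compl_subset [LocallyConnectedSpace E] {C : Set E}
    (hC : IsClosed C) (z : E) : frontier (connectedComponentIn Cᶜ z) ⊆ C := by
  intro x hx
  by_contra hxC
  have hopen : ∀ y, IsOpen (connectedComponentIn Cᶜ y) := fun y =>
    hC.isOpen_compl.connectedComponentIn
  rw [(hopen z).frontier_eq] at hx
  obtain ⟨y, hyx, hyz⟩ := mem_closure_iff.1 hx.1 _ (hopen x) (mem_connectedComponentIn hxC)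
  rw [connectedComponentIn_eq hyz, ← connectedComponentIn_eq hyx] at hx
  exact hx.2 (mem_connectedComponentIn hxC)

theorem subset_connectedComponentIn_of_inter_nonempty {S F : Set E} {z : E}
    (hS : IsPreconnected S) (hSF : S ⊆ F) (hne : (S ∩ connectedComponentIn F z).Nonempty) :
    S ⊆ connectedComponentIn F z := by
  obtain ⟨y, hyS, hyz⟩ := hne
  rw [connectedComponentIn_eq hyz]
  exact hS.subset_connectedComponentIn hyS hSF

theorem nonempty_frontier_connectedComponentIn_compl [PreconnectedSpace E]
    {C : Set E} (hC : C.Nonempty) {z : E} (hz : z ∈ Cᶜ) :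
    (frontier (connectedComponentIn Cᶜ z)).Nonempty := by
  refine nonempty_frontier_iff.2 ⟨⟨z, mem_connectedComponentIn hz⟩, fun h => ?_⟩
  obtain ⟨x, hx⟩ := hC
  exact connectedComponentIn_subset Cᶜ z (h ▸ mem_univ x) hx

end Components

/-! ### Slit balls -/

/-- A ball slit along a radius is connected, being star-shaped about each point opposite to the
slit. The condition `r ≤ dist b a` makes the segment reach the boundary of the ball. -/
theorem isPreconnected_ball_diff_segment {E : Type*} [NormedAddCommGroup E] [NormedSpace ℝ E]
    {a b : E} (hab : a ≠ b) {r : ℝ} (hr : 0 < r) (hrb : r ≤ dist b a) :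
    IsPreconnected (Metric.ball a r \ segment ℝ a b) := by
  have hd : 0 < dist b a := dist_pos.2 hab.symm
  -- The centre `a - s • (b - a)` of the star lies at distance `r / 2` from `a`, opposite to `b`.
  set s : ℝ := r / (2 * dist b a) with hs
  have hs0 : 0 < s := by positivity
  have hball : ∀ t : ℝ, a + t • (b - a) ∈ Metric.ball a r ↔ |t| * dist b a < r := by
    intro t
    rw [Metric.mem_ball, dist_eq_norm, add_sub_cancel_left, norm_smul, Real.norm_eq_abs,
      dist_eq_norm]
  have hseg : ∀ t : ℝ, 0 ≤ t → a + t • (b - a) ∈ Metric.ball a r →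
      a + t • (b - a) ∈ segment ℝ a b := by
    intro t ht h
    rw [hball, abs_of_nonneg ht] at h
    rw [segment_eq_image']
    refine ⟨t, ⟨ht, ?_⟩, rfl⟩
    by_contra! h1
    nlinarith
  have hseg' : ∀ x ∈ segment ℝ a b, ∃ t : ℝ, 0 ≤ t ∧ x = a + t • (b - a) := by
    intro x hx
    rw [segment_eq_image'] at hx
    obtain ⟨t, ht, rfl⟩ := hx
    exact ⟨t, ht.1, rfl⟩
  have hba : b - a ≠ 0 := sub_ne_zero.2 hab.symm
  have hc : a + (-s) • (b - a) ∈ Metric.ball a r := by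
    rw [hball, abs_neg, abs_of_pos hs0, hs]
    field_simp
    linarith
  have hcn : a + (-s) • (b - a) ∉ segment ℝ a b := by
    intro hn
    obtain ⟨t, ht, he⟩ := hseg' _ hn
    have := smul_left_injective ℝ hba (add_left_cancel he)
    linarith
  have hstar : StarConvex ℝ (a + (-s) • (b - a)) (Metric.ball a r \ segment ℝ a b) := by
    intro x hx p q hp hq hpq
    have hmem := convex_ball a r hc hx.1 hp hq hpq
    refine ⟨hmem, fun hn => ?_⟩
    obtain ⟨t, ht, he⟩ := hseg' _ hn
    rcases hq.eq_or_lt with rfl | hq0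
    · obtain rfl : p = 1 := by linarith
      have : (t + s) • (b - a) = 0 := by
        rw [one_smul, zero_smul, add_zero] at he
        have := add_left_cancel he
        rw [add_smul, ← this, neg_smul, neg_add_cancel]
      rcases smul_eq_zero.1 this with h | h
      · linarith
      · exact hba h
    · have hx' : x = a + ((t + p * s) / q) • (b - a) := by
        have h1 : q • x = q • (a + ((t + p * s) / q) • (b - a)) := by
          rw [smul_add, smul_smul, mul_div_cancel₀ _ hq0.ne']
          have h2 : q • x = a + t • (b - a) - p • (a + (-s) • (b - a)) := by rw [← he]; abel
          obtain rfl : p = 1 - q := by linarith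
          rw [h2]
          module
        exact smul_right_injective E hq0.ne' h1
      refine hx.2 ?_
      have hx1 := hx.1
      rw [hx'] at hx1 ⊢
      exact hseg _ (by positivity) hx1
  exact (hstar.isPathConnected ⟨hc, hcn⟩).isConnected.isPreconnected

/-! ### Simple closed polygons -/

/-- The closed polygonal curve with vertices `v 0, v 1, …, v (n - 1)`. -/
def polygonCurve {n : ℕ} (v : ZMod n → ℝ × ℝ) : Set (ℝ × ℝ) :=
  ⋃ i, segment ℝ (v i) (v (i + 1))

/-- The closed polygonal path through the vertices `v i` has at least three edges and does not
meet itself; the `i`-th edge is parametrized by `[0, 1)`, so that each vertex is counted once. -/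
structure IsSimplePolygon {n : ℕ} (v : ZMod n → ℝ × ℝ) : Prop where
  three_le : 3 ≤ n
  injOn : InjOn (fun q : ZMod n × ℝ => AffineMap.lineMap (v q.1) (v (q.1 + 1)) q.2)
    (univ ×ˢ Ico (0 : ℝ) 1)

namespace IsSimplePolygon

variable {n : ℕ} {v : ZMod n → ℝ × ℝ}

theorem neZero (h : IsSimplePolygon v) : NeZero n := ⟨by have := h.three_le; omega⟩

/-- A point of the half-open `i`-th edge lies on the closed `j`-th edge only if the edges coincide
or the point is the end point of the `j`-th and the starting point of the `i`-th edge. -/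
theorem lineMap_mem_segment_imp (h : IsSimplePolygon v) {i j : ZMod n} {s : ℝ}
    (hs : s ∈ Ico (0 : ℝ) 1)
    (hm : AffineMap.lineMap (v i) (v (i + 1)) s ∈ segment ℝ (v j) (v (j + 1))) :
    j = i ∨ (s = 0 ∧ j + 1 = i) := by
  rw [segment_eq_image_lineMap] at hm
  obtain ⟨t, ht, he⟩ := hm
  rcases ht.2.eq_or_lt with rfl | ht1
  · rw [AffineMap.lineMap_apply_one] at he
    have := @h.injOn (j + 1, 0) ⟨trivial, by simp⟩ (i, s) ⟨trivial, hs⟩ (by simpa using he)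
    rw [Prod.mk.injEq] at this
    exact Or.inr ⟨this.2.symm, this.1⟩
  · have := @h.injOn (j, t) ⟨trivial, ht.1, ht1⟩ (i, s) ⟨trivial, hs⟩ he
    exact Or.inl (Prod.mk.inj this).1

theorem eq_of_mem_openSegment_of_mem_segment (h : IsSimplePolygon v) {i j : ZMod n} {x : ℝ × ℝ}
    (hx : x ∈ openSegment ℝ (v i) (v (i + 1))) (hj : x ∈ segment ℝ (v j) (v (j + 1))) :
    j = i := by
  rw [openSegment_eq_image_lineMap] at hx
  obtain ⟨s, hs, rfl⟩ := hx
  rcases h.lineMap_mem_segment_imp (Ioo_subset_Ico_self hs) hj with h1 | ⟨h1, -⟩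
  · exact h1
  · exact absurd h1 hs.1.ne'

theorem eq_or_eq_of_vertex_mem_segment (h : IsSimplePolygon v) {i j : ZMod n}
    (hj : v i ∈ segment ℝ (v j) (v (j + 1))) : j = i ∨ j + 1 = i := by
  have := h.lineMap_mem_segment_imp (i := i) (s := 0) (by simp) (by simpa using hj)
  tauto

theorem vertex_ne (h : IsSimplePolygon v) (i : ZMod n) : v i ≠ v (i + 1) := by
  intro he
  have h1 := h.three_le
  have := @h.injOn (i, 0) ⟨trivial, by simp⟩ (i + 1, 0) ⟨trivial, by simp⟩ (by simpa using he)
  have h2 : (1 : ZMod n) = 0 := by simpa using (Prod.mk.inj this).1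
  have : Fact (1 < n) := ⟨by omega⟩
  exact one_ne_zero h2

end IsSimplePolygon

theorem isCompact_polygonCurve {n : ℕ} [NeZero n] (v : ZMod n → ℝ × ℝ) :
    IsCompact (polygonCurve v) := by
  refine isCompact_iUnion fun i => ?_
  rw [segment_eq_image_lineMap]
  exact isCompact_Icc.image AffineMap.lineMap_continuous

theorem isClosed_iUnion_segment {n : ℕ} [NeZero n] (v : ZMod n → ℝ × ℝ) (P : ZMod n → Prop) :
    IsClosed (⋃ (i) (_ : P i), segment ℝ (v i) (v (i + 1))) := by
  refine isClosed_iUnion_of_finite fun i => isClosed_iUnion_of_finite fun _ => ?_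
  rw [← closure_openSegment]
  exact isClosed_closure

theorem segment_subset_polygonCurve {n : ℕ} (v : ZMod n → ℝ × ℝ) (i : ZMod n) :
    segment ℝ (v i) (v (i + 1)) ⊆ polygonCurve v :=
  subset_iUnion (fun i => segment ℝ (v i) (v (i + 1))) i

/-! ### The two sides of an edge -/

/-- Twice the signed area of the triangle `a b z`: positive to the left of the line from `a` to
`b`, negative to its right. -/
def signedArea (a b z : ℝ × ℝ) : ℝ := (b.1 - a.1) * (z.2 - a.2) - (b.2 - a.2) * (z.1 - a.1)

theorem signedArea_eq_zero_of_mem_segment {a b z : ℝ × ℝ} (hz : z ∈ segment ℝ a b) :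
    signedArea a b z = 0 := by
  rw [segment_eq_image'] at hz
  obtain ⟨t, -, rfl⟩ := hz
  simp [signedArea]
  ring

theorem signedArea_combo (a b z w : ℝ × ℝ) {p q : ℝ} (hpq : p + q = 1) :
    signedArea a b (p • z + q • w) = p * signedArea a b z + q * signedArea a b w := by
  obtain rfl : p = 1 - q := by linarith
  simp [signedArea]
  ring

theorem convex_signedArea_pos (a b : ℝ × ℝ) (σ : ℝ) : Convex ℝ {z | 0 < σ * signedArea a b z} := by
  intro z hz w hw p q hp hq hpq
  simp only [mem_ofPred_eq] at *
  rw [signedArea_combo _ _ _ _ hpq]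
  rcases hp.eq_or_lt with rfl | hp
  · obtain rfl : q = 1 := by linarith
    simpa using hw
  · nlinarith [mul_pos hp hz, mul_nonneg hq hw.le]

/-- The vector `b - a` turned by a right angle; it points to the left of the line from `a` to `b`. -/
def leftNormal (a b : ℝ × ℝ) : ℝ × ℝ := (-(b.2 - a.2), b.1 - a.1)

theorem signedArea_add_smul_leftNormal (a b z : ℝ × ℝ) (t : ℝ) :
    signedArea a b (z + t • leftNormal a b) =
      signedArea a b z + t * ((b.1 - a.1) ^ 2 + (b.2 - a.2) ^ 2) := by
  simp [signedArea, leftNormal]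
  ring

theorem sq_add_sq_sub_pos {a b : ℝ × ℝ} (hab : a ≠ b) :
    0 < (b.1 - a.1) ^ 2 + (b.2 - a.2) ^ 2 := by
  by_contra! h
  apply hab
  ext <;> nlinarith [sq_nonneg (b.1 - a.1), sq_nonneg (b.2 - a.2)]

theorem tendsto_add_smul_leftNormal (a b z : ℝ × ℝ) (σ : ℝ) :
    Tendsto (fun t : ℝ => z + (σ * t) • leftNormal a b) (𝓝[>] 0) (𝓝 z) := by
  have : Continuous fun t : ℝ => z + (σ * t) • leftNormal a b := by fun_prop
  simpa using (this.tendsto 0).mono_left nhdsWithin_le_nhds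

/-- Each point of `B` on the line through `a` and `b` is a limit of points of the open set `B`
strictly on a prescribed side of the line. -/
theorem mem_closure_inter_side {a b q : ℝ × ℝ} (hab : a ≠ b) {B : Set (ℝ × ℝ)}
    (hB : IsOpen B) (hq : q ∈ B) (h0 : signedArea a b q = 0) {σ : ℝ} (hσ : σ ≠ 0) :
    q ∈ closure (B ∩ {z | 0 < σ * signedArea a b z}) := by
  refine mem_closure_of_tendsto (tendsto_add_smul_leftNormal a b q σ) ?_
  filter_upwards [(tendsto_add_smul_leftNormal a b q σ).eventually (hB.mem_nhds hq),
    self_mem_nhdsWithin] with t ht ht0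
  refine ⟨ht, ?_⟩
  simp only [mem_ofPred_eq, signedArea_add_smul_leftNormal, h0, zero_add]
  have := sq_add_sq_sub_pos hab
  have : 0 < σ * σ := mul_self_pos.2 hσ
  have : (0:ℝ) < t := ht0
  have : σ * (σ * t * ((b.1 - a.1) ^ 2 + (b.2 - a.2) ^ 2)) =
    (σ * σ) * (t * ((b.1 - a.1) ^ 2 + (b.2 - a.2) ^ 2)) := by ring
  rw [this]
  positivity

/-- If a ball about `p` meets the curve only in the `i`-th edge, the line of that edge cuts it into
two half balls which avoid the curve; the factor `σ = ±1` chooses the left or the right one. A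
component of the complement which has `p` in its closure contains one of them. -/
theorem exists_half_ball_subset_component {n : ℕ} {v : ZMod n → ℝ × ℝ} {i : ZMod n}
    (hne : v i ≠ v (i + 1)) {p : ℝ × ℝ} {r : ℝ} (hr : 0 < r)
    (hB : Metric.ball p r ∩ polygonCurve v ⊆ segment ℝ (v i) (v (i + 1))) {z : ℝ × ℝ}
    (hU : IsOpen (connectedComponentIn (polygonCurve v)ᶜ z))
    (hp : p ∈ closure (connectedComponentIn (polygonCurve v)ᶜ z)) :
    ∃ σ : ℝ, (σ = 1 ∨ σ = -1) ∧
      Metric.ball p r ∩ {x | 0 < σ * signedArea (v i) (v (i + 1)) x} ⊆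
        connectedComponentIn (polygonCurve v)ᶜ z := by
  set U := connectedComponentIn (polygonCurve v)ᶜ z
  obtain ⟨u, huB, huU⟩ := mem_closure_iff.1 hp _ Metric.isOpen_ball (Metric.mem_ball_self hr)
  -- Points on the line of the edge are limits of points off it, so some point of the open set
  -- `ball p r ∩ U` lies strictly on one side.
  have hex : ∃ u ∈ Metric.ball p r ∩ U, signedArea (v i) (v (i + 1)) u ≠ 0 := by
    by_cases hu0 : signedArea (v i) (v (i + 1)) u = 0
    · have := mem_closure_inter_side hne (Metric.isOpen_ball.inter hU) ⟨huB, huU⟩ hu0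
        (one_ne_zero (α := ℝ))
      obtain ⟨x, hx, hx'⟩ := (closure_nonempty_iff.1 ⟨_, this⟩)
      rw [mem_ofPred_eq, one_mul] at hx'
      exact ⟨x, hx, hx'.ne'⟩
    · exact ⟨u, ⟨huB, huU⟩, hu0⟩
  have key : ∀ σ : ℝ, ∀ x ∈ Metric.ball p r ∩ U, 0 < σ * signedArea (v i) (v (i + 1)) x →
      Metric.ball p r ∩ {x | 0 < σ * signedArea (v i) (v (i + 1)) x} ⊆ U := by
    intro σ x hx hσ
    refine subset_connectedComponentIn_of_inter_nonempty
      ((convex_ball p r).inter (convex_signedArea_pos _ _ σ)).isPreconnected ?_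
      ⟨x, ⟨hx.1, hσ⟩, hx.2⟩
    rintro y ⟨hyB, hy⟩ hyC
    rw [mem_ofPred_eq, signedArea_eq_zero_of_mem_segment (hB ⟨hyB, hyC⟩), mul_zero] at hy
    exact lt_irrefl _ hy
  obtain ⟨x, hx, hx0⟩ := hex
  rcases lt_or_gt_of_ne hx0 with hl | hl
  · exact ⟨-1, Or.inr rfl, key _ x hx (by linarith)⟩
  · exact ⟨1, Or.inl rfl, key _ x hx (by linarith)⟩

namespace IsSimplePolygon

variable {n : ℕ} {v : ZMod n → ℝ × ℝ}

theorem exists_ball_inter_subset_segment (h : IsSimplePolygon v) {i : ZMod n} {p : ℝ × ℝ}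
    (hp : p ∈ openSegment ℝ (v i) (v (i + 1))) :
    ∃ r > 0, Metric.ball p r ∩ polygonCurve v ⊆ segment ℝ (v i) (v (i + 1)) := by
  have := h.neZero
  have hcl := isClosed_iUnion_segment v (· ≠ i)
  have hpn : p ∈ (⋃ (j) (_ : j ≠ i), segment ℝ (v j) (v (j + 1)))ᶜ := by
    simp only [mem_compl_iff, mem_iUnion, not_exists]
    exact fun j hj hpj => hj (h.eq_of_mem_openSegment_of_mem_segment hp hpj)
  obtain ⟨r, hr, hsub⟩ := Metric.isOpen_iff.1 hcl.isOpen_compl p hpn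
  refine ⟨r, hr, ?_⟩
  rintro x ⟨hxB, hxC⟩
  obtain ⟨j, hj⟩ := mem_iUnion.1 hxC
  by_cases hji : j = i
  · exact hji ▸ hj
  · exact absurd (mem_iUnion₂.2 ⟨j, hji, hj⟩) (hsub hxB)

/-! ### Every component of the complement is bordered by the whole curve -/

theorem segment_subset_frontier (h : IsSimplePolygon v) {z : ℝ × ℝ} {i : ZMod n} {p : ℝ × ℝ}
    (hp : p ∈ openSegment ℝ (v i) (v (i + 1)))
    (hpF : p ∈ frontier (connectedComponentIn (polygonCurve v)ᶜ z)) :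
    segment ℝ (v i) (v (i + 1)) ⊆ frontier (connectedComponentIn (polygonCurve v)ᶜ z) := by
  have := h.neZero
  set U := connectedComponentIn (polygonCurve v)ᶜ z
  have hU : IsOpen U := (isCompact_polygonCurve v).isClosed.isOpen_compl.connectedComponentIn
  have hseg := segment_subset_polygonCurve v i
  have hnot : ∀ x ∈ segment ℝ (v i) (v (i + 1)), x ∉ U := fun x hx hxU =>
    connectedComponentIn_subset _ _ hxU (hseg hx)
  -- The points of the open edge on the frontier form a relatively open subset of it. They also form
  -- a relatively closed one, and the open edge is connected.
  have hloc : ∀ q ∈ openSegment ℝ (v i) (v (i + 1)), q ∈ frontier U →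
      ∃ r > 0, ∀ x ∈ Metric.ball q r, x ∈ openSegment ℝ (v i) (v (i + 1)) → x ∈ frontier U := by
    intro q hq hqF
    obtain ⟨r, hr, hB⟩ := h.exists_ball_inter_subset_segment hq
    obtain ⟨σ, hσ, hsub⟩ := exists_half_ball_subset_component (h.vertex_ne i) hr hB hU hqF.1
    refine ⟨r, hr, fun x hx hxs => ?_⟩
    have hxs' := openSegment_subset_segment ℝ _ _ hxs
    rw [hU.frontier_eq]
    refine ⟨closure_mono hsub ?_, hnot x hxs'⟩
    exact mem_closure_inter_side (h.vertex_ne i) Metric.isOpen_ball hx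
      (signedArea_eq_zero_of_mem_segment hxs') (by rcases hσ with rfl | rfl <;> norm_num)
  choose! r hr hsub using hloc
  set O := ⋃ (q) (_ : q ∈ openSegment ℝ (v i) (v (i + 1))) (_ : q ∈ frontier U),
    Metric.ball q (r q) with hO
  have hOo : IsOpen O := isOpen_iUnion fun q => isOpen_iUnion fun _ => isOpen_iUnion fun _ =>
    Metric.isOpen_ball
  have hmemO : ∀ q ∈ openSegment ℝ (v i) (v (i + 1)), q ∈ frontier U → q ∈ O := by
    intro q hq hqF
    simp only [hO, mem_iUnion]
    exact ⟨q, hq, hqF, Metric.mem_ball_self (hr q hq hqF)⟩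
  have hopen : openSegment ℝ (v i) (v (i + 1)) ⊆ frontier U := by
    intro x hx
    by_contra hxF
    obtain ⟨y, hy, hyO, hyF⟩ := (convex_openSegment (v i) (v (i + 1))).isPreconnected O
      (frontier U)ᶜ hOo isClosed_frontier.isOpen_compl
      (fun y hy => (em (y ∈ frontier U)).imp (hmemO y hy) id)
      ⟨p, hp, hmemO p hp hpF⟩ ⟨x, hx, hxF⟩
    simp only [hO, mem_iUnion] at hyO
    obtain ⟨q, hq, hqF, hyq⟩ := hyO
    exact hyF (hsub q hq hqF y hyq hy)
  rw [← closure_openSegment]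
  exact closure_minimal hopen isClosed_frontier

/-- The frontier of a component cannot stop at a vertex: otherwise the component would contain
a whole neighbourhood of the vertex slit along the preceding edge, and so meet the next edge. -/
theorem exists_mem_openSegment_frontier (h : IsSimplePolygon v) {z : ℝ × ℝ} {i : ZMod n}
    (hi : v (i + 1) ∈ frontier (connectedComponentIn (polygonCurve v)ᶜ z)) :
    ∃ p ∈ openSegment ℝ (v (i + 1)) (v (i + 1 + 1)),
      p ∈ frontier (connectedComponentIn (polygonCurve v)ᶜ z) := by
  have := h.neZero
  have hCc := (isCompact_polygonCurve v).isClosed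
  set U := connectedComponentIn (polygonCurve v)ᶜ z
  have hU : IsOpen U := hCc.isOpen_compl.connectedComponentIn
  by_contra! hno
  have hcl := isClosed_iUnion_segment v (fun j => j ≠ i ∧ j ≠ i + 1)
  have hpn : v (i + 1) ∈ (⋃ (j) (_ : j ≠ i ∧ j ≠ i + 1), segment ℝ (v j) (v (j + 1)))ᶜ := by
    simp only [mem_compl_iff, mem_iUnion, not_exists]
    intro j hj hpj
    rcases h.eq_or_eq_of_vertex_mem_segment hpj with h1 | h1
    · exact hj.2 h1
    · exact hj.1 (add_right_cancel h1)
  obtain ⟨r₀, hr₀, hsub⟩ := Metric.isOpen_iff.1 hcl.isOpen_compl _ hpn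
  have hd1 : 0 < dist (v i) (v (i + 1)) := dist_pos.2 (h.vertex_ne i)
  have hd2 : 0 < dist (v (i + 1 + 1)) (v (i + 1)) := dist_pos.2 (h.vertex_ne (i + 1)).symm
  obtain ⟨r, hr, hrr, hr1, hr2⟩ : ∃ r > 0, r ≤ r₀ ∧ r ≤ dist (v i) (v (i + 1)) ∧
      r ≤ dist (v (i + 1 + 1)) (v (i + 1)) :=
    ⟨min r₀ (min _ _), lt_min hr₀ (lt_min hd1 hd2), min_le_left _ _,
      (min_le_right _ _).trans (min_le_left _ _), (min_le_right _ _).trans (min_le_right _ _)⟩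
  have hlocal : Metric.ball (v (i + 1)) r ∩ polygonCurve v ⊆
      segment ℝ (v i) (v (i + 1)) ∪ openSegment ℝ (v (i + 1)) (v (i + 1 + 1)) := by
    rintro x ⟨hxB, hxC⟩
    obtain ⟨j, hj⟩ := mem_iUnion.1 hxC
    by_cases hji : j = i
    · exact Or.inl (hji ▸ hj)
    by_cases hji' : j = i + 1
    · subst hji'
      rw [← insert_endpoints_openSegment] at hj
      rcases hj with rfl | rfl | hj
      · exact Or.inl (right_mem_segment ℝ _ _)
      · exact absurd hxB (by simpa using hr2)
      · exact Or.inr hj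
    · exact absurd (mem_iUnion₂.2 ⟨j, ⟨hji, hji'⟩, hj⟩) (hsub (Metric.ball_subset_ball hrr hxB))
  have hslit := isPreconnected_ball_diff_segment (h.vertex_ne i).symm hr hr1
  rw [segment_symm] at hslit
  have hFC : frontier U ⊆ polygonCurve v := frontier_connectedComponentIn_compl_subset hCc z
  obtain ⟨u, huB, huU⟩ := mem_closure_iff.1 hi.1 _ Metric.isOpen_ball (Metric.mem_ball_self hr)
  have hUC : ∀ x ∈ polygonCurve v, x ∉ U := fun x hx hxU =>
    connectedComponentIn_subset _ _ hxU hx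
  have hall : Metric.ball (v (i + 1)) r \ segment ℝ (v i) (v (i + 1)) ⊆ U := by
    refine hslit.subset_of_disjoint_frontier hU
      ⟨u, ⟨huB, fun hu => hUC u (segment_subset_polygonCurve v i hu) huU⟩, huU⟩ ?_
    refine disjoint_left.2 fun x hx hxF => ?_
    rcases hlocal ⟨hx.1, hFC hxF⟩ with h1 | h1
    · exact hx.2 h1
    · exact hno x h1 hxF
  have hv : v (i + 1) ∈ closure (openSegment ℝ (v (i + 1)) (v (i + 1 + 1))) := by
    rw [closure_openSegment]; exact left_mem_segment ℝ _ _
  obtain ⟨x, hxB, hx⟩ := mem_closure_iff.1 hv _ Metric.isOpen_ball (Metric.mem_ball_self hr)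
  refine hUC x (segment_subset_polygonCurve v (i + 1) (openSegment_subset_segment ℝ _ _ hx))
    (hall ⟨hxB, fun hxi => ?_⟩)
  have h1 := h.eq_of_mem_openSegment_of_mem_segment hx hxi
  have h2 : (1 : ZMod n) = 0 := by simpa using h1
  have : Fact (1 < n) := ⟨by have := h.three_le; omega⟩
  exact one_ne_zero h2

/-- The frontier of a component contains a vertex, and with each vertex the edge that starts there,
hence the next vertex. -/
theorem frontier_component (h : IsSimplePolygon v) {z : ℝ × ℝ} (hz : z ∈ (polygonCurve v)ᶜ) :
    frontier (connectedComponentIn (polygonCurve v)ᶜ z) = polygonCurve v := by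
  have := h.neZero
  have hFC := frontier_connectedComponentIn_compl_subset (isCompact_polygonCurve v).isClosed z
  refine hFC.antisymm ?_
  set F := frontier (connectedComponentIn (polygonCurve v)ᶜ z)
  have hstep : ∀ i, v i ∈ F → segment ℝ (v i) (v (i + 1)) ⊆ F := by
    intro i hi
    obtain ⟨i, rfl⟩ : ∃ j, i = j + 1 := ⟨i - 1, by ring⟩
    obtain ⟨p, hp, hpF⟩ := h.exists_mem_openSegment_frontier hi
    exact h.segment_subset_frontier hp hpF
  obtain ⟨i, hi⟩ : ∃ i, v i ∈ F := by
    obtain ⟨p, hp⟩ : F.Nonempty := nonempty_frontier_connectedComponentIn_compl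
      ⟨v 0, segment_subset_polygonCurve v 0 (left_mem_segment ℝ _ _)⟩ hz
    obtain ⟨i, hi⟩ := mem_iUnion.1 (hFC hp)
    rw [← insert_endpoints_openSegment] at hi
    rcases hi with rfl | rfl | hi
    · exact ⟨i, hp⟩
    · exact ⟨i + 1, hp⟩
    · exact ⟨i, h.segment_subset_frontier hi hp (left_mem_segment ℝ _ _)⟩
  have hall : ∀ k : ℕ, v (i + k) ∈ F := by
    intro k
    induction k with
    | zero => simpa using hi
    | succ k ih =>
      have := hstep _ ih (right_mem_segment ℝ _ _)
      simpa [add_assoc] using this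
  refine iUnion_subset fun j => hstep j ?_
  have := hall (j - i).val
  rwa [ZMod.natCast_zmod_val, add_sub_cancel] at this

end IsSimplePolygon

/-! ### The winding angle -/

/-- A point of the plane as a complex number. -/
def toComplex (z : ℝ × ℝ) : ℂ := ⟨z.1, z.2⟩

theorem continuous_toComplex : Continuous toComplex :=
  Complex.equivRealProdCLM.symm.continuous

theorem toComplex_injective : Function.Injective toComplex := fun _ _ h =>
  Prod.ext (congrArg Complex.re h) (congrArg Complex.im h)

/-- The complex number `(b - z) / (a - z)`, whose argument is the signed angle under which the
segment from `a` to `b` is seen from `z`. -/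
noncomputable def viewRatio (a b z : ℝ × ℝ) : ℂ :=
  (toComplex b - toComplex z) / (toComplex a - toComplex z)

theorem toComplex_sub_ne_zero {a z : ℝ × ℝ} (h : z ≠ a) : toComplex a - toComplex z ≠ 0 :=
  sub_ne_zero.2 (toComplex_injective.ne h.symm)

theorem continuousAt_viewRatio {a b z : ℝ × ℝ} (h : z ≠ a) : ContinuousAt (viewRatio a b) z :=
  (continuous_const.sub continuous_toComplex).continuousAt.div
    (continuous_const.sub continuous_toComplex).continuousAt (toComplex_sub_ne_zero h)

theorem viewRatio_im (a b z : ℝ × ℝ) :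
    (viewRatio a b z).im = signedArea a b z / Complex.normSq (toComplex a - toComplex z) := by
  rw [viewRatio, Complex.div_im, ← sub_div]
  congr 1
  simp [toComplex, signedArea]
  ring

/-- The argument is continuous at the quotient unless `z` lies on the segment: if the quotient is a
real number `ρ ≤ 0`, then `z = (b - ρ a) / (1 - ρ)` is a convex combination of `a` and `b`. -/
theorem viewRatio_mem_slitPlane {a b z : ℝ × ℝ} (h : z ∉ segment ℝ a b) :
    viewRatio a b z ∈ Complex.slitPlane := by
  have hza : z ≠ a := fun e => h (e ▸ left_mem_segment ℝ _ _)
  by_contra hn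
  rw [Complex.mem_slitPlane_iff, not_or, not_lt, not_not] at hn
  obtain ⟨hre, him⟩ := hn
  set ρ := (viewRatio a b z).re with hρ
  have hr : viewRatio a b z = (ρ : ℂ) := Complex.ext rfl (by simpa using him)
  rw [viewRatio, div_eq_iff (toComplex_sub_ne_zero hza)] at hr
  have h1 : b.1 - z.1 = ρ * (a.1 - z.1) := by simpa [toComplex] using congrArg Complex.re hr
  have h2 : b.2 - z.2 = ρ * (a.2 - z.2) := by simpa [toComplex] using congrArg Complex.im hr
  have h0 : 0 < 1 - ρ := by linarith
  refine h ⟨-ρ / (1 - ρ), 1 / (1 - ρ), div_nonneg (by linarith) h0.le, by positivity, ?_, ?_⟩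
  · field_simp
    ring
  · ext
    · simp
      field_simp
      linarith
    · simp
      field_simp
      linarith

theorem continuousAt_arg_viewRatio {a b z : ℝ × ℝ} (h : z ∉ segment ℝ a b) :
    ContinuousAt (fun x => (viewRatio a b x).arg) z :=
  (Complex.continuousAt_arg (viewRatio_mem_slitPlane h)).comp
    (continuousAt_viewRatio fun e => h (e ▸ left_mem_segment ℝ _ _))

theorem viewRatio_midpoint {a b : ℝ × ℝ} (hab : a ≠ b) :
    viewRatio a b (midpoint ℝ a b) = -1 := by
  have hm : toComplex (midpoint ℝ a b) = (toComplex a + toComplex b) / 2 := by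
    rw [midpoint_eq_smul_add]
    apply Complex.ext <;> simp [toComplex] <;> ring
  have : toComplex a - toComplex b ≠ 0 := toComplex_sub_ne_zero hab.symm
  rw [viewRatio, hm]
  have h2 : toComplex a - (toComplex a + toComplex b) / 2 ≠ 0 := by
    intro h; apply this; linear_combination 2 * h
  rw [div_eq_iff h2]
  ring

theorem midpoint_ne_left_of_ne {a b : ℝ × ℝ} (hab : a ≠ b) : midpoint ℝ a b ≠ a := by
  simpa [midpoint_eq_left_iff] using hab

theorem tendsto_viewRatio_midpoint {a b : ℝ × ℝ} (hab : a ≠ b) (σ : ℝ) :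
    Tendsto (fun t : ℝ => viewRatio a b (midpoint ℝ a b + (σ * t) • leftNormal a b)) (𝓝[>] 0)
      (𝓝 (-1)) := by
  rw [← viewRatio_midpoint hab]
  exact (continuousAt_viewRatio (midpoint_ne_left_of_ne hab)).tendsto.comp
    (tendsto_add_smul_leftNormal a b _ σ)

theorem signedArea_midpoint_add (a b : ℝ × ℝ) (t : ℝ) :
    signedArea a b (midpoint ℝ a b + t • leftNormal a b) =
      t * ((b.1 - a.1) ^ 2 + (b.2 - a.2) ^ 2) := by
  rw [signedArea_add_smul_leftNormal, signedArea_eq_zero_of_mem_segment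
    (openSegment_subset_segment ℝ _ _ (midpoint_mem_openSegment ..)), zero_add]

/-- Seen from points approaching its midpoint from the left, the segment tends to fill a straight
angle `π`; from the right it is `-π`. -/
theorem tendsto_arg_viewRatio_left {a b : ℝ × ℝ} (hab : a ≠ b) :
    Tendsto (fun t : ℝ => (viewRatio a b (midpoint ℝ a b + ((1 : ℝ) * t) • leftNormal a b)).arg)
      (𝓝[>] 0) (𝓝 Real.pi) := by
  have h1 := Complex.tendsto_arg_nhdsWithin_im_nonneg_of_re_neg_of_im_zero (z := -1)
    (by simp) (by simp)
  refine h1.comp (tendsto_nhdsWithin_iff.2 ⟨tendsto_viewRatio_midpoint hab 1, ?_⟩)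
  filter_upwards [self_mem_nhdsWithin] with t ht
  rw [viewRatio_im, signedArea_midpoint_add]
  have := sq_add_sq_sub_pos hab
  have ht : 0 < t := ht
  exact div_nonneg (by positivity) (Complex.normSq_nonneg _)

theorem tendsto_arg_viewRatio_right {a b : ℝ × ℝ} (hab : a ≠ b) :
    Tendsto (fun t : ℝ => (viewRatio a b (midpoint ℝ a b + ((-1 : ℝ) * t) • leftNormal a b)).arg)
      (𝓝[>] 0) (𝓝 (-Real.pi)) := by
  have h1 := Complex.tendsto_arg_nhdsWithin_im_neg_of_re_neg_of_im_zero (z := -1)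
    (by simp) (by simp)
  have h2 := tendsto_viewRatio_midpoint hab (-1)
  refine h1.comp (tendsto_nhdsWithin_iff.2 ⟨h2, ?_⟩)
  filter_upwards [self_mem_nhdsWithin,
    (tendsto_add_smul_leftNormal a b (midpoint ℝ a b) (-1)).eventually_ne
      (midpoint_ne_left_of_ne hab)] with t ht hne
  rw [viewRatio_im, signedArea_midpoint_add]
  have := sq_add_sq_sub_pos hab
  have ht : 0 < t := ht
  refine div_neg_of_neg_of_pos ?_ (Complex.normSq_pos.2 (toComplex_sub_ne_zero hne))
  have : 0 < t * ((b.1 - a.1) ^ 2 + (b.2 - a.2) ^ 2) := by positivity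
  linarith

/-- Far away, every segment is seen under a small angle. -/
theorem tendsto_arg_viewRatio_cobounded (a b : ℝ × ℝ) :
    Tendsto (fun z => (viewRatio a b z).arg) (Bornology.cobounded (ℝ × ℝ)) (𝓝 0) := by
  have hT : Tendsto (fun z => toComplex a - toComplex z) (Bornology.cobounded (ℝ × ℝ))
      (Bornology.cobounded ℂ) := by
    have h1 : Tendsto toComplex (Bornology.cobounded (ℝ × ℝ)) (Bornology.cobounded ℂ) :=
      (Complex.equivRealProdCLM.symm.antilipschitz).tendsto_cobounded
    exact (tendsto_const_sub_cobounded (toComplex a)).comp h1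
  have h2 : Tendsto (viewRatio a b) (Bornology.cobounded (ℝ × ℝ)) (𝓝 1) := by
    have h3 : Tendsto (fun z => 1 + (toComplex b - toComplex a) * (toComplex a - toComplex z)⁻¹)
        (Bornology.cobounded (ℝ × ℝ)) (𝓝 (1 + (toComplex b - toComplex a) * 0)) :=
      tendsto_const_nhds.add (tendsto_const_nhds.mul (tendsto_inv₀_cobounded.comp hT))
    rw [mul_zero, add_zero] at h3
    refine h3.congr' ?_
    have hne : ∀ᶠ z in Bornology.cobounded (ℝ × ℝ), z ≠ a := by
      exact Bornology.isBounded_def.1 (Bornology.isBounded_singleton (x := a))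
    filter_upwards [hne] with z hz
    have := toComplex_sub_ne_zero hz
    rw [viewRatio]
    field_simp
    ring
  have h4 := (Complex.continuousAt_arg Complex.one_mem_slitPlane).tendsto.comp h2
  rwa [Complex.arg_one] at h4

/-- The total angle through which a point moving once around the polygon turns as seen from `z`.
For `z` off the curve it is `2π` times the winding number of the polygon about `z`. -/
noncomputable def windingAngle {n : ℕ} [NeZero n] (v : ZMod n → ℝ × ℝ) (z : ℝ × ℝ) : ℝ :=
  ∑ i, (viewRatio (v i) (v (i + 1)) z).arg

section

variable {n : ℕ} [NeZero n] (v : ZMod n → ℝ × ℝ)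

theorem continuousOn_windingAngle : ContinuousOn (windingAngle v) (polygonCurve v)ᶜ := by
  intro z hz
  refine ContinuousAt.continuousWithinAt ?_
  refine tendsto_finsetSum _ fun i _ => (continuousAt_arg_viewRatio fun h => hz ?_)
  exact segment_subset_polygonCurve v i h

/-- Modulo `2π` the argument of a quotient is a difference of arguments, and these differences
cancel around the polygon. -/
theorem windingAngle_mem_zmultiples {z : ℝ × ℝ} (hz : z ∈ (polygonCurve v)ᶜ) :
    windingAngle v z ∈ AddSubgroup.zmultiples (2 * Real.pi) := by
  have hne : ∀ i, toComplex (v i) - toComplex z ≠ 0 := fun i => toComplex_sub_ne_zero fun e =>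
    hz (segment_subset_polygonCurve v i (e ▸ left_mem_segment ℝ _ _))
  rw [AddSubgroup.mem_zmultiples_iff, ← Real.Angle.coe_eq_zero_iff]
  have h1 : ((windingAngle v z : ℝ) : Real.Angle) =
      ∑ i, ((viewRatio (v i) (v (i + 1)) z).arg : Real.Angle) :=
    map_sum Real.Angle.coeHom _ _
  have h2 : ∀ i, ((viewRatio (v i) (v (i + 1)) z).arg : Real.Angle) =
      ((toComplex (v (i + 1)) - toComplex z).arg : Real.Angle) -
        ((toComplex (v i) - toComplex z).arg : Real.Angle) := fun i =>
    Complex.arg_div_coe_angle (hne _) (hne _)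
  rw [h1, Finset.sum_congr rfl fun i _ => h2 i, Finset.sum_sub_distrib, sub_eq_zero]
  exact Equiv.sum_comp (Equiv.addRight (1 : ZMod n))
    fun i => ((toComplex (v i) - toComplex z).arg : Real.Angle)

theorem IsPreconnected.windingAngle_eq {S : Set (ℝ × ℝ)} (hS : IsPreconnected S)
    (hSC : S ⊆ (polygonCurve v)ᶜ) {z w : ℝ × ℝ} (hz : z ∈ S) (hw : w ∈ S) :
    windingAngle v z = windingAngle v w :=
  hS.constant_of_mapsTo (T := (AddSubgroup.zmultiples (2 * Real.pi) : Set ℝ))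
    (SetLike.isDiscrete_iff_discreteTopology.2 inferInstance)
    ((continuousOn_windingAngle v).mono hSC)
    (fun _ hx => windingAngle_mem_zmultiples v (hSC hx)) hz hw

theorem eventually_windingAngle_eq_zero :
    ∀ᶠ z in Bornology.cobounded (ℝ × ℝ), windingAngle v z = 0 := by
  have h1 : Tendsto (windingAngle v) (Bornology.cobounded (ℝ × ℝ)) (𝓝 (∑ _i : ZMod n, 0)) :=
    tendsto_finsetSum _ fun i _ => tendsto_arg_viewRatio_cobounded _ _
  rw [Finset.sum_const_zero] at h1
  have hb : (polygonCurve v)ᶜ ∈ Bornology.cobounded (ℝ × ℝ) :=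
    (isCompact_polygonCurve v).isBounded
  filter_upwards [h1.eventually (Metric.ball_mem_nhds 0 one_pos), hb] with z hz hzC
  obtain ⟨k, hk⟩ := AddSubgroup.mem_zmultiples_iff.1 (windingAngle_mem_zmultiples v hzC)
  rw [dist_zero_right, Real.norm_eq_abs, ← hk, zsmul_eq_mul, abs_mul,
    abs_of_pos Real.two_pi_pos] at hz
  have hk0 : k = 0 := by
    by_contra hk0
    have h3 : (1 : ℝ) ≤ |(k : ℝ)| := by exact_mod_cast Int.one_le_abs hk0
    nlinarith [Real.pi_gt_three]
  rw [← hk, hk0, zero_smul]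

end

namespace IsSimplePolygon

variable {n : ℕ} {v : ZMod n → ℝ × ℝ}

/-- Crossing an edge at its midpoint changes the winding angle: the term of that edge jumps
by `2π` and the other terms are continuous there. -/
theorem eventually_windingAngle_ne [NeZero n] (h : IsSimplePolygon v) (i : ZMod n) :
    ∀ᶠ t : ℝ in 𝓝[>] 0,
      windingAngle v (midpoint ℝ (v i) (v (i + 1)) + ((1 : ℝ) * t) • leftNormal (v i) (v (i + 1))) ≠
      windingAngle v
        (midpoint ℝ (v i) (v (i + 1)) + ((-1 : ℝ) * t) • leftNormal (v i) (v (i + 1))) := by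
  set p := midpoint ℝ (v i) (v (i + 1)) with hp
  have hrest : ∀ σ : ℝ, Tendsto (fun t : ℝ => ∑ j ∈ Finset.univ.erase i,
      (viewRatio (v j) (v (j + 1)) (p + (σ * t) • leftNormal (v i) (v (i + 1)))).arg) (𝓝[>] 0)
      (𝓝 (∑ j ∈ Finset.univ.erase i, (viewRatio (v j) (v (j + 1)) p).arg)) := by
    intro σ
    refine tendsto_finsetSum _ fun j hj => ?_
    have hpj : p ∉ segment ℝ (v j) (v (j + 1)) := fun hpj => Finset.ne_of_mem_erase hj
      (h.eq_of_mem_openSegment_of_mem_segment (midpoint_mem_openSegment ..) hpj)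
    exact (continuousAt_arg_viewRatio hpj).tendsto.comp (tendsto_add_smul_leftNormal _ _ p σ)
  have hL := (tendsto_arg_viewRatio_left (h.vertex_ne i)).add (hrest 1)
  have hR := (tendsto_arg_viewRatio_right (h.vertex_ne i)).add (hrest (-1))
  have hsum : ∀ x, windingAngle v x = (viewRatio (v i) (v (i + 1)) x).arg +
      ∑ j ∈ Finset.univ.erase i, (viewRatio (v j) (v (j + 1)) x).arg := fun x =>
    (Finset.add_sum_erase _ _ (Finset.mem_univ i)).symm
  simp only [hsum]
  refine ((hL.sub hR).eventually_ne (b₂ := 0) fun h0 => ?_).mono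
    fun t ht he => ht (sub_eq_zero.2 he)
  linarith [Real.pi_pos]

/-! ### The Jordan curve theorem for polygons -/

/-- The complement of the curve has at most two components: each of them borders on a fixed edge,
and therefore contains one of the two sides of that edge near its midpoint. -/
theorem exists_two_components [NeZero n] (h : IsSimplePolygon v) :
    ∃ x ∈ (polygonCurve v)ᶜ, ∃ y ∈ (polygonCurve v)ᶜ, windingAngle v x ≠ windingAngle v y ∧
      ∀ z ∈ (polygonCurve v)ᶜ,
        connectedComponentIn (polygonCurve v)ᶜ z = connectedComponentIn (polygonCurve v)ᶜ x ∨
        connectedComponentIn (polygonCurve v)ᶜ z = connectedComponentIn (polygonCurve v)ᶜ y := by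
  have hCo := (isCompact_polygonCurve v).isClosed.isOpen_compl
  set a := v 0
  set b := v (0 + 1)
  set p := midpoint ℝ a b with hp
  have hab : a ≠ b := h.vertex_ne 0
  obtain ⟨r, hr, hB⟩ := h.exists_ball_inter_subset_segment (i := 0) (p := p)
    (midpoint_mem_openSegment ..)
  have hball : ∀ σ : ℝ, ∀ᶠ t : ℝ in 𝓝[>] 0, p + (σ * t) • leftNormal a b ∈ Metric.ball p r :=
    fun σ => (tendsto_add_smul_leftNormal a b p σ).eventually (Metric.ball_mem_nhds p hr)
  obtain ⟨t, hw, hL, hR, ht⟩ := ((h.eventually_windingAngle_ne 0).and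
    ((hball 1).and ((hball (-1)).and self_mem_nhdsWithin))).exists
  have ht : 0 < t := ht
  have hpos := sq_add_sq_sub_pos hab
  have harea : ∀ s : ℝ, signedArea a b (p + s • leftNormal a b) =
      s * ((b.1 - a.1) ^ 2 + (b.2 - a.2) ^ 2) := signedArea_midpoint_add a b
  have hC : ∀ s : ℝ, s ≠ 0 → p + s • leftNormal a b ∈ Metric.ball p r →
      p + s • leftNormal a b ∈ (polygonCurve v)ᶜ := by
    intro s hs hsB hsC
    have := signedArea_eq_zero_of_mem_segment (hB ⟨hsB, hsC⟩)
    exact mul_ne_zero hs hpos.ne' ((harea s).symm.trans this)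
  refine ⟨_, hC _ (by simpa using ht.ne') hL, _, hC _ (by simpa using ht.ne') hR, hw, ?_⟩
  intro z hz
  have hpU : p ∈ closure (connectedComponentIn (polygonCurve v)ᶜ z) := by
    refine frontier_subset_closure ?_
    rw [h.frontier_component hz]
    exact segment_subset_polygonCurve v 0 (openSegment_subset_segment ℝ _ _
      (midpoint_mem_openSegment ..))
  obtain ⟨σ, hσ, hsub⟩ := exists_half_ball_subset_component hab hr hB hCo.connectedComponentIn hpU
  have hmem : ∀ τ : ℝ, 0 < τ * (τ * t) → p + (τ * t) • leftNormal a b ∈ Metric.ball p r →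
      p + (τ * t) • leftNormal a b ∈
        Metric.ball p r ∩ {x | 0 < τ * signedArea a b x} := by
    refine fun τ hτ hτB => ⟨hτB, ?_⟩
    rw [mem_ofPred_eq, harea, ← mul_assoc]
    exact mul_pos hτ hpos
  rcases hσ with rfl | rfl
  · exact Or.inl (connectedComponentIn_eq (hsub (hmem 1 (by linarith) hL)))
  · exact Or.inr (connectedComponentIn_eq (hsub (hmem (-1) (by linarith) hR)))

/-- Unbounded components contain points far away, which have winding angle zero; so of the two
components, one is unbounded because the curve is bounded, and the other, whose winding angle
differs, is bounded. -/
theorem satisfiesJordanCurveTheorem (h : IsSimplePolygon v) :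
    SatisfiesJordanCurveTheorem (polygonCurve v) := by
  have := h.neZero
  have hCo := (isCompact_polygonCurve v).isClosed.isOpen_compl
  have hCb := (isCompact_polygonCurve v).isBounded
  set C := polygonCurve v
  have hnb : ¬ Bornology.IsBounded Cᶜ := fun hb =>
    NormedSpace.unbounded_univ ℝ (ℝ × ℝ) (union_compl_self C ▸ hCb.union hb)
  have hzero : ∀ z ∈ Cᶜ, ¬ Bornology.IsBounded (connectedComponentIn Cᶜ z) →
      windingAngle v z = 0 := by
    intro z hz hzb
    have hev := eventually_windingAngle_eq_zero v
    by_contra hne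
    refine hzb ?_
    rw [Bornology.isBounded_def]
    filter_upwards [hev] with x hx hxU
    refine hne (hx ▸ isPreconnected_connectedComponentIn.windingAngle_eq v
      (connectedComponentIn_subset _ _) (mem_connectedComponentIn hz) hxU)
  obtain ⟨x, hx, y, hy, hxb, hyb, hcov⟩ : ∃ x ∈ Cᶜ, ∃ y ∈ Cᶜ,
      Bornology.IsBounded (connectedComponentIn Cᶜ x) ∧
      ¬ Bornology.IsBounded (connectedComponentIn Cᶜ y) ∧
      ∀ z ∈ Cᶜ, connectedComponentIn Cᶜ z = connectedComponentIn Cᶜ x ∨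
        connectedComponentIn Cᶜ z = connectedComponentIn Cᶜ y := by
    obtain ⟨x, hx, y, hy, hw, hcov⟩ := h.exists_two_components
    by_cases hxb : Bornology.IsBounded (connectedComponentIn Cᶜ x)
    · refine ⟨x, hx, y, hy, hxb, fun hyb => hnb ((hxb.union hyb).subset fun z hz => ?_), hcov⟩
      have hzz := mem_connectedComponentIn hz
      rcases hcov z hz with e | e
      · exact Or.inl (e ▸ hzz)
      · exact Or.inr (e ▸ hzz)
    · refine ⟨y, hy, x, hx, ?_, hxb, fun z hz => (hcov z hz).symm⟩
      by_contra hyb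
      exact hw ((hzero x hx hxb).trans (hzero y hy hyb).symm)
  have hin : insideOf C = connectedComponentIn Cᶜ x := by
    ext z
    refine ⟨fun ⟨hz, hzb⟩ => ?_, fun hz => ⟨connectedComponentIn_subset _ _ hz, ?_⟩⟩
    · rcases hcov z hz with e | e
      · exact e ▸ mem_connectedComponentIn hz
      · exact absurd (e ▸ hzb) hyb
    · exact connectedComponentIn_eq hz ▸ hxb
  have hout : outsideOf C = connectedComponentIn Cᶜ y := by
    ext z
    refine ⟨fun ⟨hz, hzb⟩ => ?_, fun hz => ⟨connectedComponentIn_subset _ _ hz, ?_⟩⟩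
    · rcases hcov z hz with e | e
      · exact absurd hxb (e ▸ hzb)
      · exact e ▸ mem_connectedComponentIn hz
    · exact connectedComponentIn_eq hz ▸ hyb
  refine
    { disjoint := disjoint_left.2 fun z hz hz' => hz'.2 hz.2
      union_eq := ?_
      isOpen_inside := hin ▸ hCo.connectedComponentIn
      isOpen_outside := hout ▸ hCo.connectedComponentIn
      isConnected_inside := hin ▸ isConnected_connectedComponentIn_iff.2 hx
      isConnected_outside := hout ▸ isConnected_connectedComponentIn_iff.2 hy
      isBounded_inside := hin ▸ hxb
      not_isBounded_outside := hout ▸ hyb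
      frontier_inside := hin ▸ h.frontier_component hx
      frontier_outside := hout ▸ h.frontier_component hy }
  ext z
  refine ⟨fun hz => hz.elim And.left And.left, fun hz => ?_⟩
  exact (em _).imp (fun hb => ⟨hz, hb⟩) (fun hb => ⟨hz, hb⟩)

end IsSimplePolygon

/-! ### Frames and 1-cycles -/

theorem PictureElement.cell_mem_nhds (p : PictureElement) : p.cell ∈ 𝓝 p.loc := by
  have : Metric.ball p.loc (1 / 2) ⊆ p.cell := by
    intro z hz
    rw [Metric.mem_ball, Prod.dist_eq, max_lt_iff, Real.dist_eq, Real.dist_eq] at hz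
    exact ⟨hz.1.le, hz.2.le⟩
  exact Filter.mem_of_superset (Metric.ball_mem_nhds _ (by norm_num)) this

namespace VideoFrame.OneCycle

variable {X : Set PictureElement} {fr : VideoFrame X}

theorem satisfiesJordanCurveTheorem (c : fr.OneCycle) : SatisfiesJordanCurveTheorem c.curve :=
  IsSimplePolygon.satisfiesJordanCurveTheorem (v := fun i => (c.vertex i).loc)
    ⟨c.three_le, c.simple⟩

/-- The cell of a vertex of the cycle is a neighbourhood of a point of the curve. -/
theorem region_inter_nonempty (c : fr.OneCycle) {S : Set (ℝ × ℝ)} (hS : frontier S = c.curve) :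
    (fr.region ∩ S).Nonempty := by
  have h0 : (c.vertex 0).loc ∈ closure S := by
    refine frontier_subset_closure (hS ▸ mem_iUnion.2 ⟨0, left_mem_segment ℝ _ _⟩)
  obtain ⟨z, hz, hzS⟩ := mem_closure_iff_nhds.1 h0 _ (c.vertex 0).cell_mem_nhds
  exact ⟨z, mem_iUnion₂.2 ⟨_, c.vertex_mem 0, hz⟩, hzS⟩

/-- The exterior is connected and avoids the frontier of `K`, so it could only meet `K` by lying
within it, which is impossible for an unbounded set. -/
theorem disjoint_outside (c : fr.OneCycle) {K : Set (ℝ × ℝ)} (hK : Bornology.IsBounded K)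
    (hKf : frontier K = c.curve) : Disjoint K c.outside := by
  have hJ := c.satisfiesJordanCurveTheorem
  have hd : Disjoint c.outside (frontier K) := disjoint_left.2 fun z hz hz' => hz.1 (hKf ▸ hz')
  have hint : ∀ z ∈ K, z ∈ c.outside → z ∈ interior K := fun z hz hzo => by
    by_contra hn
    exact disjoint_left.1 hd hzo ⟨subset_closure hz, hn⟩
  refine disjoint_left.2 fun z hz hzo => hJ.not_isBounded_outside (hK.subset ?_)
  refine (hJ.isConnected_outside.isPreconnected.subset_of_disjoint_frontier isOpen_interior
    ⟨z, hzo, hint z hz hzo⟩ (hd.mono_right frontier_interior_subset)).trans interior_subset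

end VideoFrame.OneCycle

theorem mainTheorem3 {X : Set PictureElement} (fr : VideoFrame X) (A : fr.Subimage)
    (c : fr.OneCycle) (hc : c.IsAttachedTo A) :
    SatisfiesJordanCurveTheorem c.curve ∧
    (fr.region \ c.curve = (fr.region ∩ c.inside) ∪ (fr.region ∩ c.outside) ∧
      Disjoint (fr.region ∩ c.inside) (fr.region ∩ c.outside) ∧
      (fr.region ∩ c.inside).Nonempty ∧
      (fr.region ∩ c.outside).Nonempty) ∧
    (fr.carrier =
        fr.elementsIn c.inside ∪ fr.elementsIn c.curve ∪ fr.elementsIn c.outside ∧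
      Disjoint (fr.elementsIn c.inside) (fr.elementsIn c.outside) ∧
      Disjoint (fr.elementsIn c.inside) (fr.elementsIn c.curve) ∧
      Disjoint (fr.elementsIn c.outside) (fr.elementsIn c.curve)) ∧
    (c.Bounds A →
      A.carrier ⊆ fr.elementsIn c.inside ∪ fr.elementsIn c.curve ∧
      Disjoint A.carrier (fr.elementsIn c.outside)) := by
  have hJ := c.satisfiesJordanCurveTheorem
  have hio : Disjoint c.inside c.outside := hJ.disjoint
  have hun : c.inside ∪ c.outside = c.curveᶜ := hJ.union_eq
  have htri : ∀ z, z ∈ c.inside ∨ z ∈ c.curve ∨ z ∈ c.outside := by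
    intro z
    by_cases hz : z ∈ c.curve
    · exact Or.inr (Or.inl hz)
    · have : z ∈ c.inside ∪ c.outside := hun ▸ hz
      exact this.imp id Or.inr
  refine ⟨hJ, ⟨?_, hio.mono inter_subset_right inter_subset_right,
    c.region_inter_nonempty hJ.frontier_inside, c.region_inter_nonempty hJ.frontier_outside⟩,
    ⟨?_, ?_, ?_, ?_⟩, ?_⟩
  · rw [← inter_union_distrib_left, hun, sdiff_eq]
  · ext p
    refine ⟨fun hp => ?_, fun hp => hp.elim (fun h => h.elim And.left And.left) And.left⟩
    rcases htri p.loc with h | h | h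
    · exact Or.inl (Or.inl ⟨hp, h⟩)
    · exact Or.inl (Or.inr ⟨hp, h⟩)
    · exact Or.inr ⟨hp, h⟩
  · exact disjoint_left.2 fun p hp hp' => disjoint_left.1 hio hp.2 hp'.2
  · exact disjoint_left.2 fun p hp hp' => hp.2.1 hp'.2
  · exact disjoint_left.2 fun p hp hp' => hp.2.1 hp'.2
  · rintro ⟨K, hK, hKf, hA⟩
    have hd := c.disjoint_outside hK hKf
    have hno : ∀ p ∈ A.carrier, p.loc ∉ c.outside := fun p hp =>
      disjoint_left.1 hd (hA p hp)
    refine ⟨fun p hp => ?_, disjoint_left.2 fun p hp hp' => hno p hp hp'.2⟩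
    rcases htri p.loc with h | h | h
    · exact Or.inl ⟨A.subset hp, h⟩
    · exact Or.inr ⟨A.subset hp, h⟩
    · exact absurd h (hno p hp)
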